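/- The board is the infinite square grid, whose cells are identified with $\mathbb{Z}^2$ (each cell is named by its lower left lattice point). Let $P_5$ be the straight polyomino of five cells; its copies are the sets of five consecutive cells in a row or in a column. A pairing for $P_5$ is a bijection $\rho : X \to Y$ between disjoint sets $X, Y \subseteq \mathbb{Z}^2$ such that every copy $A$ of $P_5$ contains a pair, i.e. there is $x \in X$ with $\{x, \rho(x)\} \subseteq A$; it is identified with its set of pairs $\{\{x,\rho(x)\} : x \in X\}$. (Neither $X \cup Y = \mathbb{Z}^2$ nor that paired cells are close to each other is assumed.) Call $\{(x,y),(x+1,y)\}$ the lying domino at $(x,y)$ and $\{(x,y),(x,y+1)\}$ the standing domino at $(x,y)$. Define two sets of pairs: - $T_1$ (a chessboard with $2\times 2$ fields packed alternately by two lying and two standing dominoes): for all $i,j \in \mathbb{Z}$, the lying dominoes at $(2i,2j)$ and $(2i,2j+1)$ if $i+j$ is even, and the standing dominoes at $(2i,2j)$ and $(2i+1,2j)$ if $i+j$ is odd. - $T_2$ (the "zipper"): the lying dominoes at all $(x,y)$ with $x-y \equiv 0 \pmod 4$, and the standing dominoes at all $(x,y)$ with $x-y\equiv 3 \pmod 4$.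 **Lemma 9.** For every pairing $\rho : X \to Y$ for $P_5$, the set of pairs $\{\{x,\rho(x)\} : x \in X\}$ is the image of $T_1$ or of $T_2$ under a rotation of the grid by a multiple of $90^\circ$ followed by a translation by a vector of $\mathbb{Z}^2$. -/

import Mathlib

/-- Winning pairing strategy for Breaker on the hypergraph with vertex type `V` and edge set `E`:
a bijection `ρ` from `X` onto `Y`, where `X` and `Y` are disjoint sets of vertices, such that every
edge contains some pair `{x, ρ x}` with `x ∈ X`. Values of `ρ` outside `X` play no role. -/
structure IsWinningPairing {V : Type*} (E : Set (Set V)) (X Y : Set V) (ρ : V → V) : Prop where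
  disjoint : Disjoint X Y
  bijOn : Set.BijOn ρ X Y
  blocks : ∀ A ∈ E, ∃ x ∈ X, ({x, ρ x} : Set V) ⊆ A

/-- The set of unordered pairs `{x, ρ x}`, `x ∈ X`. -/
def pairsOf {V : Type*} (X : Set V) (ρ : V → V) : Set (Sym2 V) :=
  (fun x => s(x, ρ x)) '' X

/-- Cells of the infinite square grid; a cell is named by its lower left lattice point. -/
abbrev Cell : Type := ℤ × ℤ

/-- The copies of the straight polyomino `P_ℓ` in the grid: all sets of `ℓ` consecutive cells
of a row or of a column. -/
def straightPolyominoes (ℓ : ℕ) : Set (Set Cell) :=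
  {A | ∃ a b : ℤ, A = {c | ∃ i : ℕ, i < ℓ ∧ c = (a + i, b)} ∨
                  A = {c | ∃ i : ℕ, i < ℓ ∧ c = (a, b + i)}}

/-- The lying domino with left cell `(x, y)`. -/
def lying (x y : ℤ) : Sym2 Cell := s((x, y), (x + 1, y))

/-- The standing domino with lower cell `(x, y)`. -/
def standing (x y : ℤ) : Sym2 Cell := s((x, y), (x, y + 1))

/-- `T₁`: the grid is cut into the `2 × 2` fields with lower left cells `(2 * i, 2 * j)`; a field
is packed with two lying dominoes if `i + j` is even, with two standing dominoes if it is odd. -/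
def patternT1 : Set (Sym2 Cell) :=
  {p | ∃ i j : ℤ, Even (i + j) ∧ (p = lying (2 * i) (2 * j) ∨ p = lying (2 * i) (2 * j + 1))} ∪
  {p | ∃ i j : ℤ, Odd (i + j) ∧ (p = standing (2 * i) (2 * j) ∨ p = standing (2 * i + 1) (2 * j))}

/-- `T₂`: diagonal staircases of lying dominoes, each shifted by one against the next, alternate
with diagonal staircases of standing dominoes. The cells with `x - y ≡ 0, 1 (mod 4)` are covered by
the lying dominoes and those with `x - y ≡ 2, 3 (mod 4)` by the standing ones. -/
def patternT2 : Set (Sym2 Cell) :=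
  {p | ∃ x y : ℤ, x - y ≡ 0 [ZMOD 4] ∧ p = lying x y} ∪
  {p | ∃ x y : ℤ, x - y ≡ 3 [ZMOD 4] ∧ p = standing x y}

/-- Rotation of the grid by a quarter turn. -/
def quarterTurn (c : Cell) : Cell := (-c.2, c.1)

/-- `S` is a translated and rotated copy of `T`: the image of `T` under `k` quarter turns
followed by the translation by `t`. -/
def IsCopy (S T : Set (Sym2 Cell)) : Prop :=
  ∃ (k : ℕ) (t : Cell), S = Sym2.map (fun c => quarterTurn^[k] c + t) '' T

/-!
Two overlapping windows of five cells show that any four consecutive cells of a row contain at least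
two cells paired within that row; the same holds for columns. A `4 × 4` square has sixteen cells, so
both bounds are equalities everywhere and every cell is paired within its row or within its column.
Consequently, being paired within the row is a `4`-periodic property along each row. If `c` and
`c + 4` lack it, the pair in the window from `c` to `c + 4` lies strictly between them. This forces
a shift by two cells to interchange the cells paired within their row with the others, and the pairs
to be dominoes. Such a set of cells is determined by its restriction to two adjacent rows: the
shift modulo `4` between these yields two translates of `T₁`, a translate of `T₂`, and a translate
of `T₂` turned by `90°`.
-/

open Finset

section DoubleCounting

variable {α β : Type*}

theorem card_filter_add_card_filter_eq_card_filter_or (s : Finset α) {p q : α → Prop}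
    [DecidablePred p] [DecidablePred q] (hpq : ∀ x, p x → ¬ q x) :
    #{x ∈ s | p x} + #{x ∈ s | q x} = #{x ∈ s | p x ∨ q x} := by
  classical
  rw [filter_or, card_union_of_disjoint (disjoint_filter.2 fun x _ => hpq x)]

variable {s : Finset α} {t : Finset β} {h v : α → β → Prop}
  [∀ x y, Decidable (h x y)] [∀ x y, Decidable (v x y)] {r c : ℕ}

theorem card_filter_eq_and_cover_of_card_mul_card_le (hhv : ∀ x y, h x y → ¬ v x y)
    (hr : ∀ y ∈ t, r ≤ #{x ∈ s | h x y}) (hc : ∀ x ∈ s, c ≤ #{y ∈ t | v x y})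
    (hst : #s * #t ≤ #t * r + #s * c) :
    (∀ y ∈ t, #{x ∈ s | h x y} = r) ∧ (∀ x ∈ s, #{y ∈ t | v x y} = c) ∧
      ∀ x ∈ s, ∀ y ∈ t, h x y ∨ v x y := by
  have hor : ∀ y ∈ t, #{x ∈ s | h x y ∨ v x y} ≤ #s := fun y _ => card_filter_le _ _
  have hsum : ∑ y ∈ t, #{x ∈ s | h x y} + ∑ x ∈ s, #{y ∈ t | v x y} =
      ∑ y ∈ t, #{x ∈ s | h x y ∨ v x y} := by
    rw [show ∑ x ∈ s, #{y ∈ t | v x y} = ∑ y ∈ t, #{x ∈ s | v x y} from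
      sum_card_bipartiteAbove_eq_sum_card_bipartiteBelow v, ← sum_add_distrib]
    exact sum_congr rfl fun y _ =>
      card_filter_add_card_filter_eq_card_filter_or s fun x => hhv x y
  have hr' := sum_le_sum hr
  have hc' := sum_le_sum hc
  have hor' := sum_le_sum hor
  simp only [sum_const, smul_eq_mul] at hr' hc' hor'
  rw [mul_comm #s #t] at hst
  refine ⟨fun y hy => ?_, fun x hx => ?_, fun x hx y hy => ?_⟩
  · refine ((sum_eq_sum_iff_of_le hr).1 ?_ y hy).symm
    rw [sum_const, smul_eq_mul]
    lia
  · refine ((sum_eq_sum_iff_of_le hc).1 ?_ x hx).symm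
    rw [sum_const, smul_eq_mul]
    lia
  · have hcard : #{x ∈ s | h x y ∨ v x y} = #s := by
      refine (sum_eq_sum_iff_of_le hor).1 ?_ y hy
      rw [sum_const, smul_eq_mul]
      lia
    exact card_filter_eq_iff.1 hcard x hx

end DoubleCounting

section Windows

variable {p : ℤ → Prop}

theorem periodic_of_card_filter_Ico_eq [DecidablePred p] {n k : ℕ}
    (hp : ∀ a : ℤ, #{x ∈ Ico a (a + n) | p x} = k) : Function.Periodic p (n : ℤ) := by
  intro a
  rcases n.eq_zero_or_pos with rfl | hn
  · simp
  have hleft := hp a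
  have hright := hp (a + 1)
  rw [← insert_Ico_add_one_left_eq_Ico (by lia), filter_insert] at hleft
  rw [add_right_comm, ← insert_Ico_right_eq_Ico_add_one (by lia), filter_insert] at hright
  by_cases p a <;> by_cases p (a + n) <;> simp_all

theorem iff_of_add_two_iff_not (hp : ∀ a, p (a + 2) ↔ ¬ p a) (x : ℤ) :
    p x ↔ (p (x % 2) ↔ x % 4 < 2) := by
  have hper : Function.Periodic p 4 := fun a => propext <| by
    rw [show a + 4 = a + 2 + 2 by ring, hp, hp, not_not]
  have hmod : p x ↔ p (x % 4) := by
    conv_lhs => rw [← Int.emod_add_mul_ediv x 4, mul_comm]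
    exact iff_of_eq (hper.int_mul _ _)
  have h2 : p 2 ↔ ¬ p 0 := hp 0
  have h3 : p 3 ↔ ¬ p 1 := hp 1
  obtain ⟨e, e'⟩ | ⟨e, e'⟩ | ⟨e, e'⟩ | ⟨e, e'⟩ : x % 4 = 0 ∧ x % 2 = 0 ∨ x % 4 = 1 ∧ x % 2 = 1 ∨
      x % 4 = 2 ∧ x % 2 = 0 ∨ x % 4 = 3 ∧ x % 2 = 1 := by lia
  all_goals rw [hmod, e, e']; simp [h2, h3]

theorem exists_forall_iff_sub_emod_four_lt_two (hp : ∀ a, p (a + 2) ↔ ¬ p a) :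
    ∃ s : ℤ, ∀ x, p x ↔ (x - s) % 4 < 2 := by
  obtain ⟨s, h0, h1⟩ : ∃ s : ℤ, (p 0 ↔ (0 - s) % 4 < 2) ∧ (p 1 ↔ (1 - s) % 4 < 2) := by
    by_cases h0 : p 0 <;> by_cases h1 : p 1
    exacts [⟨0, by simp [*]⟩, ⟨3, by simp [*]⟩, ⟨1, by simp [*]⟩, ⟨2, by simp [*]⟩]
  refine ⟨s, fun x => ?_⟩
  rw [iff_of_add_two_iff_not hp]
  rcases Int.emod_two_eq_zero_or_one x with e | e <;> rw [e]
  · rw [h0]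
    lia
  · rw [h1]
    lia

end Windows

/-- `G` encodes a pairing for the straight polyomino of `ℓ` cells on a one-dimensional board: its
edges are the pairs, so no vertex has two neighbours, and every `ℓ` consecutive integers contain an
edge. The integers that belong to a pair form `G.support`. -/
structure IsLinePairing (ℓ : ℕ) (G : SimpleGraph ℤ) : Prop where
  rightUnique : Relator.RightUnique G.Adj
  exists_adj : ∀ a : ℤ, ∃ x y : ℤ, a ≤ x ∧ x < y ∧ y < a + ℓ ∧ G.Adj x y

namespace IsLinePairing

variable {G : SimpleGraph ℤ} [DecidablePred (· ∈ G.support)] {n : ℕ}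

theorem two_le_card_support (hG : IsLinePairing (n + 1) G) (a : ℤ) :
    2 ≤ #{x ∈ Ico a (a + n) | x ∈ G.support} := by
  suffices ∃ x y, a ≤ x ∧ x < a + n ∧ a ≤ y ∧ y < a + n ∧ x ≠ y ∧
      x ∈ G.support ∧ y ∈ G.support by
    obtain ⟨x, y, hx, hx', hy, hy', hxy, hGx, hGy⟩ := this
    exact one_lt_card.2 ⟨x, by simp [*], y, by simp [*], hxy⟩
  obtain ⟨x, y, hx, hxy, hy, hadj⟩ := hG.exists_adj a
  obtain ⟨x', y', hx', hxy', hy', hadj'⟩ := hG.exists_adj (a - 1)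
  by_cases hyn : y < a + n
  · exact ⟨x, y, hx, by lia, by lia, hyn, hxy.ne, ⟨_, hadj⟩, ⟨_, hadj.symm⟩⟩
  by_cases hxa : a ≤ x'
  · exact ⟨x', y', hxa, by lia, by lia, by lia, hxy'.ne, ⟨_, hadj'⟩, ⟨_, hadj'.symm⟩⟩
  refine ⟨x, y', hx, by lia, by lia, by lia, ?_, ⟨_, hadj⟩, ⟨_, hadj'.symm⟩⟩
  rintro rfl
  have := hG.rightUnique hadj hadj'.symm
  lia

theorem exists_adj_of_notMem_support {k : ℕ} (hG : IsLinePairing (n + 1) G)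
    (hk : ∀ a : ℤ, #{x ∈ Ico a (a + n) | x ∈ G.support} = k) {a : ℤ} (ha : a ∉ G.support) :
    ∃ x y, a < x ∧ x < y ∧ y < a + n ∧ G.Adj x y := by
  obtain ⟨x, y, hx, hxy, hy, hadj⟩ := hG.exists_adj a
  have hxa : x ≠ a := fun h => ha (h ▸ ⟨y, hadj⟩)
  have hya : y ≠ a + n := by
    rintro rfl
    have hper := periodic_of_card_filter_Ico_eq hk a
    exact ha (hper ▸ ⟨x, hadj.symm⟩)
  exact ⟨x, y, by lia, hxy, by lia, hadj⟩

theorem add_two_mem_support (hG : IsLinePairing 5 G)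
    (htwo : ∀ a : ℤ, #{x ∈ Ico a (a + 4) | x ∈ G.support} = 2) {a : ℤ} (ha : a ∉ G.support) :
    a + 2 ∈ G.support := by
  by_contra ha2
  have ha4 : a + 4 ∉ G.support := (periodic_of_card_filter_Ico_eq (n := 4) htwo a).symm ▸ ha
  have hskip : ∀ b, b ∉ G.support → b + 2 ∉ G.support → G.Adj (b + 1) (b + 3) := by
    intro b hb hb2
    obtain ⟨x, y, hx, hxy, hy, hadj⟩ := exists_adj_of_notMem_support (n := 4) hG htwo hb
    have hx2 : x ≠ b + 2 := fun h => hb2 (h ▸ ⟨y, hadj⟩)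
    have hy2 : y ≠ b + 2 := fun h => hb2 (h ▸ ⟨x, hadj.symm⟩)
    obtain rfl : x = b + 1 := by lia
    obtain rfl : y = b + 3 := by lia
    exact hadj
  have h13 := hskip a ha ha2
  have h35 := hskip (a + 2) ha2 (by rwa [show a + 2 + 2 = a + 4 by ring])
  rw [show a + 2 + 1 = a + 3 by ring] at h35
  have := hG.rightUnique h13.symm h35
  lia

theorem add_two_mem_support_iff (hG : IsLinePairing 5 G)
    (htwo : ∀ a : ℤ, #{x ∈ Ico a (a + 4) | x ∈ G.support} = 2) {a : ℤ} :
    a + 2 ∈ G.support ↔ a ∉ G.support := by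
  refine ⟨fun ha2 ha => ?_, hG.add_two_mem_support htwo⟩
  obtain ⟨b, hb, hbw⟩ : ∃ b ∈ G.support, b = a + 1 ∨ b = a + 3 := by
    by_cases ha1 : a + 1 ∈ G.support
    · exact ⟨_, ha1, .inl rfl⟩
    · exact ⟨_, hG.add_two_mem_support htwo ha1, .inr (by ring)⟩
  have hthree : 2 < #{x ∈ Ico a (a + 4) | x ∈ G.support} := by
    refine two_lt_card.2 ⟨a, ?_, a + 2, ?_, b, ?_, by lia, by lia, by lia⟩
    · simp [ha]
    · simp [ha2]
    · exact mem_filter.2 ⟨mem_Ico.2 (by lia), hb⟩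
  exact hthree.ne' (htwo a)

theorem adj_add_one (hG : IsLinePairing 5 G)
    (htwo : ∀ a : ℤ, #{x ∈ Ico a (a + 4) | x ∈ G.support} = 2) {a : ℤ} (ha : a ∈ G.support)
    (ha' : a - 1 ∉ G.support) : G.Adj a (a + 1) := by
  obtain ⟨x, y, hx, hxy, hy, hadj⟩ := exists_adj_of_notMem_support (n := 4) hG htwo ha'
  have ha2 : a + 2 ∉ G.support := fun h => (hG.add_two_mem_support_iff htwo).1 h ha
  have hy2 : y ≠ a + 2 := fun h => ha2 (h ▸ ⟨x, hadj.symm⟩)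
  obtain rfl : x = a := by lia
  obtain rfl : y = x + 1 := by lia
  exact hadj

end IsLinePairing

theorem edgeSet_eq_of_subset_of_forall_exists_mem {V : Type*} {G : SimpleGraph V}
    (hG : Relator.RightUnique G.Adj) {S : Set (Sym2 V)} (hS : S ⊆ G.edgeSet)
    (hcover : ∀ a, ∃ b, s(a, b) ∈ S) : G.edgeSet = S := by
  refine Set.Subset.antisymm (fun q hq => ?_) hS
  induction q with
  | h a b =>
    obtain ⟨c, hc⟩ := hcover a
    have hbc : b = c := hG hq (hS hc)
    rwa [hbc]

/-- The graph whose edges are the pairs `{x, ρ x}`, `x ∈ X`, of a pairing. -/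
def pairingGraph {V : Type*} (X : Set V) (ρ : V → V) : SimpleGraph V :=
  SimpleGraph.fromEdgeSet (pairsOf X ρ)

namespace IsWinningPairing

variable {V : Type*} {E : Set (Set V)} {X Y : Set V} {ρ : V → V}

theorem apply_notMem (h : IsWinningPairing E X Y ρ) {x : V} (hx : x ∈ X) : ρ x ∉ X :=
  Set.disjoint_right.1 h.disjoint (h.bijOn.mapsTo hx)

theorem pairingGraph_adj_iff (h : IsWinningPairing E X Y ρ) {a b : V} :
    (pairingGraph X ρ).Adj a b ↔ a ∈ X ∧ ρ a = b ∨ b ∈ X ∧ ρ b = a := by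
  have hne : ∀ x ∈ X, ρ x ≠ x := fun x hx e => h.apply_notMem hx (e.symm ▸ hx)
  simp only [pairingGraph, SimpleGraph.fromEdgeSet_adj, pairsOf, Set.mem_image, Sym2.eq_iff]
  grind

theorem edgeSet_pairingGraph (h : IsWinningPairing E X Y ρ) :
    (pairingGraph X ρ).edgeSet = pairsOf X ρ := by
  rw [pairingGraph, SimpleGraph.edgeSet_fromEdgeSet, sdiff_eq_left, Set.disjoint_left]
  rintro _ ⟨x, hx, rfl⟩ hdiag
  have hρ : x = ρ x := hdiag
  exact h.apply_notMem hx (hρ ▸ hx)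

theorem rightUnique_pairingGraph_adj (h : IsWinningPairing E X Y ρ) :
    Relator.RightUnique (pairingGraph X ρ).Adj := by
  intro a b c hb hc
  rw [h.pairingGraph_adj_iff] at hb hc
  rcases hb with ⟨ha, rfl⟩ | ⟨hb, rfl⟩ <;> rcases hc with ⟨ha', rfl⟩ | ⟨hc, hca⟩
  · rfl
  · exact (h.apply_notMem hc (hca ▸ ha)).elim
  · exact (h.apply_notMem hb ha').elim
  · exact h.bijOn.injOn hb hc hca.symm

theorem exists_adj (h : IsWinningPairing E X Y ρ) {A : Set V} (hA : A ∈ E) :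
    ∃ a ∈ A, ∃ b ∈ A, (pairingGraph X ρ).Adj a b := by
  obtain ⟨x, hx, hxA⟩ := h.blocks A hA
  exact ⟨x, hxA (by simp), ρ x, hxA (by simp), h.pairingGraph_adj_iff.2 (.inl ⟨hx, rfl⟩)⟩

theorem isLinePairing_comap (h : IsWinningPairing E X Y ρ) {ℓ : ℕ} {f : ℤ → V}
    (hf : f.Injective) (hE : ∀ a : ℤ, {c | ∃ i : ℕ, i < ℓ ∧ c = f (a + i)} ∈ E) :
    IsLinePairing ℓ ((pairingGraph X ρ).comap f) where
  rightUnique _ _ _ hb hc := hf (h.rightUnique_pairingGraph_adj hb hc)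
  exists_adj a := by
    obtain ⟨_, ⟨i, hi, rfl⟩, _, ⟨j, hj, rfl⟩, hadj⟩ := h.exists_adj (hE a)
    rcases lt_trichotomy i j with hij | rfl | hij
    · exact ⟨a + i, a + j, by lia, by lia, by lia, hadj⟩
    · exact (hadj.ne rfl).elim
    · exact ⟨a + j, a + i, by lia, by lia, by lia, hadj.symm⟩

end IsWinningPairing

/-- The part of a graph on the grid inside row `y`, as a graph on the integers. -/
def rowGraph (G : SimpleGraph Cell) (y : ℤ) : SimpleGraph ℤ :=
  G.comap fun x => (x, y)

/-- The part of a graph on the grid inside column `x`, as a graph on the integers. -/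
def columnGraph (G : SimpleGraph Cell) (x : ℤ) : SimpleGraph ℤ :=
  G.comap fun y => (x, y)

theorem notMem_support_columnGraph {G : SimpleGraph Cell} (hG : Relator.RightUnique G.Adj)
    {x y : ℤ} (hx : x ∈ (rowGraph G y).support) : y ∉ (columnGraph G x).support := by
  obtain ⟨z, hz⟩ := hx
  rintro ⟨w, hw⟩
  obtain rfl : z = x := congrArg Prod.fst (hG hz hw)
  exact hz.ne rfl

open scoped Classical in
theorem tight_rowGraph_columnGraph {G : SimpleGraph Cell} (hG : Relator.RightUnique G.Adj)
    (hrow : ∀ y, IsLinePairing 5 (rowGraph G y)) (hcol : ∀ x, IsLinePairing 5 (columnGraph G x))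
    (x y : ℤ) :
    #{i ∈ Ico x (x + 4) | i ∈ (rowGraph G y).support} = 2 ∧
      #{j ∈ Ico y (y + 4) | j ∈ (columnGraph G x).support} = 2 ∧
      (y ∈ (columnGraph G x).support ↔ x ∉ (rowGraph G y).support) := by
  obtain ⟨hrow', hcol', hcover⟩ := card_filter_eq_and_cover_of_card_mul_card_le
    (s := Ico x (x + 4)) (t := Ico y (y + 4)) (h := fun i j => i ∈ (rowGraph G j).support)
    (v := fun i j => j ∈ (columnGraph G i).support) (r := 2) (c := 2)
    (fun _ _ => notMem_support_columnGraph hG)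
    (fun j _ => (hrow j).two_le_card_support x) (fun i _ => (hcol i).two_le_card_support y)
    (by simp)
  have hx : x ∈ Ico x (x + 4) := by simp
  have hy : y ∈ Ico y (y + 4) := by simp
  exact ⟨hrow' y hy, hcol' x hx, fun h h' => notMem_support_columnGraph hG h' h,
    (hcover x hx y hy).resolve_left⟩

/-- A set `m` of marked cells of the grid which a shift by two cells in either direction carries
onto its complement. For a pairing for `P₅`, the cells paired within their row form such a set. -/
structure IsAlternating (m : ℤ → ℤ → Prop) : Prop where
  add_two_left : ∀ x y, m (x + 2) y ↔ ¬ m x y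
  add_two_right : ∀ x y, m x (y + 2) ↔ ¬ m x y

/-- The domino arrangement of a set `m` of marked cells: a lying domino starts where a horizontal
run of marked cells starts, a standing one where a vertical run of unmarked cells starts. -/
def dominoes (m : ℤ → ℤ → Prop) : Set (Sym2 Cell) :=
  {p | ∃ x y, m x y ∧ ¬ m (x - 1) y ∧ p = lying x y} ∪
  {p | ∃ x y, ¬ m x y ∧ m x (y - 1) ∧ p = standing x y}

namespace IsAlternating

variable {m : ℤ → ℤ → Prop}

theorem add_one_left (hm : IsAlternating m) (x y : ℤ) : m (x + 1) y ↔ ¬ m (x - 1) y := by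
  rw [← hm.add_two_left, show x - 1 + 2 = x + 1 by ring]

theorem add_one_right (hm : IsAlternating m) (x y : ℤ) : m x (y + 1) ↔ ¬ m x (y - 1) := by
  rw [← hm.add_two_right, show y - 1 + 2 = y + 1 by ring]

theorem exists_mem_dominoes (hm : IsAlternating m) (c : Cell) : ∃ d, s(c, d) ∈ dominoes m := by
  obtain ⟨x, y⟩ := c
  have hleft := hm.add_one_left (x - 1) y
  have hdown := hm.add_one_right x (y - 1)
  rw [sub_add_cancel] at hleft hdown
  by_cases h : m x y
  · by_cases h' : m (x - 1) y
    · exact ⟨(x - 1, y), .inl ⟨x - 1, y, h', by tauto, by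
        rw [lying, sub_add_cancel, Sym2.eq_swap]⟩⟩
    · exact ⟨(x + 1, y), .inl ⟨x, y, h, h', rfl⟩⟩
  · by_cases h' : m x (y - 1)
    · exact ⟨(x, y + 1), .inr ⟨x, y, h, h', rfl⟩⟩
    · exact ⟨(x, y - 1), .inr ⟨x, y - 1, h', by tauto, by
        rw [standing, sub_add_cancel, Sym2.eq_swap]⟩⟩

theorem eq_checkerboard_or_eq_diagonal (hm : IsAlternating m) :
    (∃ a b : ℤ, m = fun x y => ((x - a) % 4 < 2 ↔ (y - b) % 4 < 2)) ∨
    (∃ a : ℤ, m = fun x y => (x - y - a) % 4 < 2) ∨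
    (∃ a : ℤ, m = fun x y => (x + y - a) % 4 < 2) := by
  obtain ⟨a, ha⟩ := exists_forall_iff_sub_emod_four_lt_two (p := (m · 0)) (hm.add_two_left · 0)
  obtain ⟨b, hb⟩ := exists_forall_iff_sub_emod_four_lt_two (p := (m · 1)) (hm.add_two_left · 1)
  have hrows : ∀ x y, m x y ↔ ((y % 2 = 0 ∧ (x - a) % 4 < 2 ∨ y % 2 = 1 ∧ (x - b) % 4 < 2) ↔
      y % 4 < 2) := by
    intro x y
    rw [iff_of_add_two_iff_not (hm.add_two_right x)]
    rcases Int.emod_two_eq_zero_or_one y with e | e <;> simp [e, ha, hb]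
  have eq_of_rows : ∀ {m' : ℤ → ℤ → Prop}, (∀ x y,
      ((y % 2 = 0 ∧ (x - a) % 4 < 2 ∨ y % 2 = 1 ∧ (x - b) % 4 < 2) ↔ y % 4 < 2) ↔ m' x y) →
      m = m' :=
    fun hm' => funext₂ fun x y => propext ((hrows x y).trans (hm' x y))
  obtain h | h | h | h :
      (b - a) % 4 = 0 ∨ (b - a) % 4 = 1 ∨ (b - a) % 4 = 2 ∨ (b - a) % 4 = 3 := by lia
  · exact .inl ⟨a, 0, eq_of_rows (by lia)⟩
  · exact .inr (.inl ⟨a, eq_of_rows (by lia)⟩)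
  · exact .inl ⟨a, -1, eq_of_rows (by lia)⟩
  · exact .inr (.inr ⟨a, eq_of_rows (by lia)⟩)

end IsAlternating

theorem isAlternating_sub_emod_four : IsAlternating fun x y => (x - y) % 4 < 2 where
  add_two_left x y := by lia
  add_two_right x y := by lia

theorem map_add_lying (x y a b : ℤ) :
    Sym2.map (· + (a, b)) (lying x y) = lying (x + a) (y + b) := by
  simp [lying, add_right_comm]

theorem map_add_standing (x y a b : ℤ) :
    Sym2.map (· + (a, b)) (standing x y) = standing (x + a) (y + b) := by
  simp [standing, add_right_comm]

theorem map_quarterTurn_lying (x y : ℤ) :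
    Sym2.map quarterTurn (lying x y) = standing (-y) x := by
  simp [lying, standing, quarterTurn]

theorem map_quarterTurn_standing (x y : ℤ) :
    Sym2.map quarterTurn (standing x y) = lying (-y - 1) x := by
  rw [lying, Sym2.eq_swap]
  simp [standing, quarterTurn, sub_eq_neg_add]

theorem image_add_dominoes (m : ℤ → ℤ → Prop) (a b : ℤ) :
    Sym2.map (· + (a, b)) '' dominoes m = dominoes fun x y => m (x - a) (y - b) := by
  refine Set.Subset.antisymm ?_ ?_
  · rintro _ ⟨_, ⟨x, y, h, h', rfl⟩ | ⟨x, y, h, h', rfl⟩, rfl⟩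
    · exact .inl ⟨x + a, y + b, by simpa, by simpa [sub_right_comm], map_add_lying ..⟩
    · exact .inr ⟨x + a, y + b, by simpa, by simpa [sub_right_comm], map_add_standing ..⟩
  · rintro _ (⟨x, y, h, h', rfl⟩ | ⟨x, y, h, h', rfl⟩)
    · exact ⟨_, .inl ⟨x - a, y - b, h, by rwa [sub_right_comm], rfl⟩, by simp [map_add_lying]⟩
    · exact ⟨_, .inr ⟨x - a, y - b, h, by rwa [sub_right_comm], rfl⟩, by simp [map_add_standing]⟩

theorem image_quarterTurn_dominoes {m : ℤ → ℤ → Prop} (hm : IsAlternating m) :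
    Sym2.map quarterTurn '' dominoes m = dominoes fun x y => ¬ m y (-x) := by
  refine Set.Subset.antisymm ?_ ?_
  · rintro _ ⟨_, ⟨x, y, h, h', rfl⟩ | ⟨x, y, h, h', rfl⟩, rfl⟩
    · exact .inr ⟨-y, x, by simpa, by simpa, map_quarterTurn_lying ..⟩
    · refine .inl ⟨-y - 1, x, ?_, ?_, map_quarterTurn_standing ..⟩
      · beta_reduce
        rwa [show -(-y - 1) = y + 1 by ring, hm.add_one_right, not_not]
      · beta_reduce
        rwa [show -(-y - 1 - 1) = y + 2 by ring, hm.add_two_right, not_not]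
  · rintro _ (⟨x, y, h, h', rfl⟩ | ⟨x, y, h, h', rfl⟩)
    · refine ⟨_, .inr ⟨y, -x - 1, ?_, ?_, rfl⟩, by simp [map_quarterTurn_standing]⟩
      · rwa [← hm.add_one_right, ← not_not (a := m y _), show -x + 1 = -(x - 1) by ring]
      · rwa [← not_not (a := m y _), ← hm.add_two_right, show -x - 1 - 1 + 2 = -x by ring]
    · exact ⟨_, .inl ⟨y, -x, not_not.1 h, h', rfl⟩, by simp [map_quarterTurn_lying]⟩

theorem patternT1_eq_dominoes : patternT1 = dominoes fun x y => (x % 4 < 2 ↔ y % 4 < 2) := by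
  refine Set.Subset.antisymm ?_ ?_
  · rintro _ (⟨i, j, h, rfl | rfl⟩ | ⟨i, j, h, rfl | rfl⟩)
    · rw [Int.even_iff] at h
      exact .inl ⟨_, _, by lia, by lia, rfl⟩
    · rw [Int.even_iff] at h
      exact .inl ⟨_, _, by lia, by lia, rfl⟩
    · rw [Int.odd_iff] at h
      exact .inr ⟨_, _, by lia, by lia, rfl⟩
    · rw [Int.odd_iff] at h
      exact .inr ⟨_, _, by lia, by lia, rfl⟩
  · rintro _ (⟨x, y, h, h', rfl⟩ | ⟨x, y, h, h', rfl⟩)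
    · refine .inl ⟨x / 2, y / 2, Int.even_iff.2 (by lia), ?_⟩
      obtain hy | hy : y = 2 * (y / 2) ∨ y = 2 * (y / 2) + 1 := by lia
      · exact .inl (congrArg₂ lying (by lia) hy)
      · exact .inr (congrArg₂ lying (by lia) hy)
    · refine .inr ⟨x / 2, y / 2, Int.odd_iff.2 (by lia), ?_⟩
      obtain hx | hx : x = 2 * (x / 2) ∨ x = 2 * (x / 2) + 1 := by lia
      · exact .inl (congrArg₂ standing hx (by lia))
      · exact .inr (congrArg₂ standing hx (by lia))

theorem patternT2_eq_dominoes : patternT2 = dominoes fun x y => (x - y) % 4 < 2 := by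
  simp only [patternT2, dominoes, Int.ModEq]
  congr! 7 with x y x y <;> lia

theorem isCopy_patternT1 (a b : ℤ) :
    IsCopy (dominoes fun x y => ((x - a) % 4 < 2 ↔ (y - b) % 4 < 2)) patternT1 := by
  refine ⟨0, (a, b), ?_⟩
  rw [patternT1_eq_dominoes]
  exact (image_add_dominoes (fun x y => (x % 4 < 2 ↔ y % 4 < 2)) a b).symm

theorem isCopy_patternT2 (a : ℤ) :
    IsCopy (dominoes fun x y => (x - y - a) % 4 < 2) patternT2 := by
  refine ⟨0, (a, 0), ?_⟩
  calc dominoes (fun x y => (x - y - a) % 4 < 2)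
      = dominoes fun x y => (x - a - (y - 0)) % 4 < 2 := by
        simp only [sub_zero, sub_right_comm]
    _ = Sym2.map (· + (a, 0)) '' patternT2 := by
        rw [patternT2_eq_dominoes, image_add_dominoes]

theorem isCopy_patternT2_of_quarterTurn (a : ℤ) :
    IsCopy (dominoes fun x y => (x + y - a) % 4 < 2) patternT2 := by
  refine ⟨1, (a - 2, 0), ?_⟩
  calc dominoes (fun x y => (x + y - a) % 4 < 2)
      = dominoes fun x y => ¬ ((y - 0) - -(x - (a - 2))) % 4 < 2 := by
        congr! 3 with x y
        lia
    _ = Sym2.map (· + (a - 2, 0)) '' (Sym2.map quarterTurn '' patternT2) := by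
        rw [patternT2_eq_dominoes, image_quarterTurn_dominoes isAlternating_sub_emod_four,
          image_add_dominoes]
    _ = Sym2.map (fun c => quarterTurn^[1] c + (a - 2, 0)) '' patternT2 := by
        simp only [Set.image_image, Sym2.map_map]
        rfl

namespace IsWinningPairing

variable {X Y : Set Cell} {ρ : Cell → Cell}

theorem isLinePairing_row {ℓ : ℕ} (h : IsWinningPairing (straightPolyominoes ℓ) X Y ρ) (y : ℤ) :
    IsLinePairing ℓ (rowGraph (pairingGraph X ρ) y) :=
  h.isLinePairing_comap (Prod.mk_left_injective y) fun a => ⟨a, y, .inl rfl⟩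

theorem isLinePairing_column {ℓ : ℕ} (h : IsWinningPairing (straightPolyominoes ℓ) X Y ρ) (x : ℤ) :
    IsLinePairing ℓ (columnGraph (pairingGraph X ρ) x) :=
  h.isLinePairing_comap (Prod.mk_right_injective x) fun a => ⟨x, a, .inr rfl⟩

theorem exists_isAlternating (h : IsWinningPairing (straightPolyominoes 5) X Y ρ) :
    ∃ m, IsAlternating m ∧ pairsOf X ρ = dominoes m := by
  classical
  set G := pairingGraph X ρ
  have tight := tight_rowGraph_columnGraph h.rightUnique_pairingGraph_adj h.isLinePairing_row
    h.isLinePairing_column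
  have hrow := fun y x => (tight x y).1
  have hcol := fun x y => (tight x y).2.1
  have hiff := fun x y => (tight x y).2.2
  have hm : IsAlternating fun x y => x ∈ (rowGraph G y).support :=
    { add_two_left x y := (h.isLinePairing_row y).add_two_mem_support_iff (hrow y)
      add_two_right x y := by
        rw [← not_iff_not, ← hiff, ← hiff]
        exact (h.isLinePairing_column x).add_two_mem_support_iff (hcol x) }
  refine ⟨_, hm, ?_⟩
  rw [← h.edgeSet_pairingGraph]
  refine edgeSet_eq_of_subset_of_forall_exists_mem h.rightUnique_pairingGraph_adj ?_
    hm.exists_mem_dominoes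
  rintro _ (⟨x, y, hxy, hxy', rfl⟩ | ⟨x, y, hxy, hxy', rfl⟩)
  · exact (h.isLinePairing_row y).adj_add_one (hrow y) hxy hxy'
  · exact (h.isLinePairing_column x).adj_add_one (hcol x) ((hiff x y).2 hxy)
      fun hy => (hiff x (y - 1)).1 hy hxy'

end IsWinningPairing

theorem lemma9 (X Y : Set Cell) (ρ : Cell → Cell)
    (h : IsWinningPairing (straightPolyominoes 5) X Y ρ) :
    IsCopy (pairsOf X ρ) patternT1 ∨ IsCopy (pairsOf X ρ) patternT2 := by
  obtain ⟨m, hm, hpairs⟩ := h.exists_isAlternating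
  rw [hpairs]
  rcases hm.eq_checkerboard_or_eq_diagonal with ⟨a, b, rfl⟩ | ⟨a, rfl⟩ | ⟨a, rfl⟩
  · exact .inl (isCopy_patternT1 a b)
  · exact .inr (isCopy_patternT2 a)
  · exact .inr (isCopy_patternT2_of_quarterTurn a)
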